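/- A solution is a triple $(X,\sigma,\tau)$ consisting of a set $X$ and maps $\sigma,\tau\colon X^2\to X$, with $\sigma_x=\sigma(x,\cdot)$ and $\tau_y=\tau(\cdot,y)$, such that all $\sigma_x,\tau_y$ are bijections of $X$ and the map $r(x,y)=(\sigma_x(y),\tau_y(x))$ satisfies $r^2=\mathrm{id}_{X^2}$ and the braid relation $(\mathrm{id}\times r)(r\times \mathrm{id})(\mathrm{id}\times r)=(r\times \mathrm{id})(\mathrm{id}\times r)(r\times \mathrm{id})$. Two solutions $(X,\sigma,\tau)$ and $(X',\sigma',\tau')$ are isomorphic if there is a bijection $\Phi\colon X\to X'$ with $\Phi\sigma_x=\sigma'_{\Phi(x)}\Phi$ for all $x\in X$. Put $x\sim y$ if $\tau_x=\tau_y$; the quotient $\mathrm{Ret}(X)=X/{\sim}$ is again a solution with the induced maps. The solution has multipermutation level $2$ if $|\mathrm{Ret}(X)|\neq 1$ and $|\mathrm{Ret}(\mathrm{Ret}(X))|=1$. Let $\mathcal G(X)=\langle\sigma_x : x\in X\rangle$ and $\mathrm{Dis}(X)=\langle\sigma_x\sigma_y^{-1} : x,y\in X\rangle$ (subgroups of the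 symmetric group of $X$), and write $\mathcal G(X)_e$, $\mathrm{Dis}(X)_e$ for the stabilizers of $e\in X$. The solution is indecomposable if $\mathcal G(X)$ acts transitively on $X$. Proposition. Let $p$ be a prime number, let $k\ge 1$, let $A$ be a cyclic group of order $p^k$ and let $m>1$ be an integer. Then, up to isomorphism, there are only finitely many indecomposable solutions $(X,\sigma,\tau)$ of multipermutation level $2$ such that, for every $e\in X$, $\mathrm{Dis}(X)_e$ is normal in $\mathrm{Dis}(X)$, $\mathrm{Dis}(X)/\mathrm{Dis}(X)_e\cong A$ and $[\mathcal G(X):\mathcal G(X)_e\,\mathrm{Dis}(X)]=m$, and their number is $$p^{km-m-k+2}\cdot\frac{p^{m-1}-1}{p-1}.$$ -/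

import Mathlib

universe u v

/-- The map `r(x, y) = (σ_x(y), τ_y(x))` determined by two families of maps. -/
def ybMap {X : Type u} (σ τ : X → X → X) (q : X × X) : X × X :=
  (σ q.1 q.2, τ q.2 q.1)

/-- `r × id` on `X³`. -/
def ybFst {X : Type u} (r : X × X → X × X) (t : X × X × X) : X × X × X :=
  ((r (t.1, t.2.1)).1, (r (t.1, t.2.1)).2, t.2.2)

/-- `id × r` on `X³`. -/
def ybSnd {X : Type u} (r : X × X → X × X) (t : X × X × X) : X × X × X :=
  (t.1, r t.2)

/-- A (set-theoretic, non-degenerate, involutive) solution of the Yang-Baxter equation on `X`.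
Non-degeneracy is built in: `σ x` is the permutation `σ_x = σ(x, _)` and `τ y` is the
permutation `τ_y = τ(_, y)`.  Bijectivity of `r` follows from involutivity. -/
structure YBSolution (X : Type u) where
  σ : X → Equiv.Perm X
  τ : X → Equiv.Perm X
  braid : ∀ t : X × X × X,
    ybSnd (ybMap (fun x => σ x) (fun y => τ y)) (ybFst (ybMap (fun x => σ x) (fun y => τ y))
      (ybSnd (ybMap (fun x => σ x) (fun y => τ y)) t)) =
    ybFst (ybMap (fun x => σ x) (fun y => τ y)) (ybSnd (ybMap (fun x => σ x) (fun y => τ y))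
      (ybFst (ybMap (fun x => σ x) (fun y => τ y)) t))
  involutive : Function.Involutive (ybMap (fun x => σ x) (fun y => τ y))

namespace YBSolution

variable {X : Type u}

/-- The equivalence relation `x ∼ y ↔ τ(_, x) = τ(_, y)`. -/
def retSetoid (S : YBSolution X) : Setoid X where
  r x y := S.τ x = S.τ y
  iseqv := ⟨fun _ => rfl, fun h => h.symm, fun h h' => h.trans h'⟩

section RetractionWellDefined

variable (S : YBSolution X)

theorem inv_fst (x y : X) : S.σ (S.σ x y) (S.τ y x) = x :=
  congrArg Prod.fst (S.involutive (x, y))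

theorem inv_snd (x y : X) : S.τ (S.τ y x) (S.σ x y) = y :=
  congrArg Prod.snd (S.involutive (x, y))

theorem braid_fst (x y z : X) : S.σ x (S.σ y z) = S.σ (S.σ x y) (S.σ (S.τ y x) z) :=
  congrArg (fun t => t.1) (S.braid (x, y, z))

theorem braid_thd (x y z : X) :
    S.τ (S.τ z y) (S.τ (S.σ y z) x) = S.τ z (S.τ y x) :=
  congrArg (fun t => t.2.2) (S.braid (x, y, z))

theorem braid_snd (x y z : X) :
    S.σ (S.τ (S.σ y z) x) (S.τ z y) = S.τ (S.σ (S.τ y x) z) (S.σ x y) :=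
  congrArg (fun t => t.2.1) (S.braid (x, y, z))

/-- The diagonal map `x ↦ σ_x⁻¹(x)`. -/
def diag (x : X) : X := (S.σ x).symm x

theorem σ_diag (x : X) : S.σ x (S.diag x) = x := (S.σ x).apply_symm_apply x

theorem τ_diag (x : X) : S.τ (S.diag x) x = S.diag x := by
  have h := S.inv_fst x (S.diag x)
  rw [S.σ_diag] at h
  exact (S.σ x).injective (h.trans (S.σ_diag x).symm)

theorem diag_injective : Function.Injective S.diag := by
  intro x y h
  have hy := S.τ_diag y
  rw [← h] at hy
  exact (S.τ (S.diag x)).injective ((S.τ_diag x).trans hy.symm)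

theorem diag_surjective : Function.Surjective S.diag := by
  intro w
  refine ⟨(S.τ w).symm w, ?_⟩
  have hy : S.τ w ((S.τ w).symm w) = w := (S.τ w).apply_symm_apply w
  have h := S.inv_snd ((S.τ w).symm w) w
  rw [hy] at h
  have h2 := (S.τ w).injective (h.trans hy.symm)
  exact (S.σ _).injective ((S.σ_diag _).trans h2.symm)

theorem diag_σ (z y : X) : S.diag (S.σ z y) = S.σ (S.τ y z) (S.diag y) := by
  apply (S.σ (S.σ z y)).injective
  rw [S.σ_diag, ← S.braid_fst, S.σ_diag]

theorem diag_τ (x y : X) : S.σ x (S.diag (S.τ x y)) = S.diag y := by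
  have h := S.diag_σ (S.σ y x) (S.τ x y)
  rw [S.inv_fst, S.inv_snd] at h
  exact h.symm

theorem τ_eq_iff_σ_eq {x y : X} : S.τ x = S.τ y ↔ S.σ x = S.σ y := by
  constructor
  · intro h
    ext w
    obtain ⟨z, rfl⟩ := S.diag_surjective w
    have hx := S.diag_τ x ((S.τ x).symm z)
    have hy := S.diag_τ y ((S.τ x).symm z)
    rw [← h] at hy
    rw [(S.τ x).apply_symm_apply] at hx hy
    exact hx.trans hy.symm
  · intro h
    ext z
    have hx := S.diag_τ x z
    have hy := S.diag_τ y z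
    rw [← h] at hy
    exact S.diag_injective ((S.σ x).injective (hx.trans hy.symm))

theorem ret_σ {x x' y y' : X} (hx : S.τ x = S.τ x') (hy : S.τ y = S.τ y') :
    S.τ (S.σ x y) = S.τ (S.σ x' y') := by
  rw [← S.τ_eq_iff_σ_eq.1 hx, S.τ_eq_iff_σ_eq]
  ext w
  have h1 := S.braid_fst x y ((S.σ (S.τ y x)).symm w)
  have h2 := S.braid_fst x y' ((S.σ (S.τ y x)).symm w)
  rw [← hy] at h2
  rw [Equiv.apply_symm_apply] at h1 h2
  rw [← h1, ← h2, S.τ_eq_iff_σ_eq.1 hy]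

theorem ret_τ {x x' y y' : X} (hx : S.τ x = S.τ x') (hy : S.τ y = S.τ y') :
    S.τ (S.τ y x) = S.τ (S.τ y' x') := by
  rw [← hy]
  ext w
  have h1 := S.braid_thd ((S.τ (S.σ x y)).symm w) x y
  have h2 := S.braid_thd ((S.τ (S.σ x y)).symm w) x' y
  rw [← S.τ_eq_iff_σ_eq.1 hx] at h2
  rw [Equiv.apply_symm_apply] at h1 h2
  rw [h1, h2, hx]

theorem σ_symm_eq (x u : X) :
    (S.σ x).symm u = S.τ ((S.σ u).symm x) u := by
  rw [Equiv.symm_apply_eq]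
  have h := S.inv_fst u ((S.σ u).symm x)
  rw [Equiv.apply_symm_apply] at h
  exact h.symm

theorem τ_symm_eq (y v : X) :
    (S.τ y).symm v = S.σ ((S.τ v).symm y) v := by
  rw [Equiv.symm_apply_eq]
  have h := S.inv_snd ((S.τ v).symm y) v
  rw [Equiv.apply_symm_apply] at h
  exact h.symm

theorem ret_σ_symm {x x' y y' : X} (hx : S.τ x = S.τ x') (hy : S.τ y = S.τ y') :
    S.τ ((S.σ x).symm y) = S.τ ((S.σ x').symm y') := by
  rw [← S.τ_eq_iff_σ_eq.1 hx, S.σ_symm_eq x y, S.σ_symm_eq x y',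
    ← S.τ_eq_iff_σ_eq.1 hy]
  exact S.ret_τ hy rfl

theorem ret_τ_symm {x x' y y' : X} (hx : S.τ x = S.τ x') (hy : S.τ y = S.τ y') :
    S.τ ((S.τ x).symm y) = S.τ ((S.τ x').symm y') := by
  rw [← hx, S.τ_symm_eq x y, S.τ_symm_eq x y', ← hy]
  exact S.ret_σ rfl hy

end RetractionWellDefined

/-- The underlying set `X/∼` of the retraction. -/
def RetType (S : YBSolution X) : Type u := Quotient S.retSetoid

/-- The permutation `[y] ↦ [σ_x(y)]` of `X/∼`, for a class `c = [x]`. -/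
def retσ (S : YBSolution X) (c : S.RetType) : Equiv.Perm S.RetType where
  toFun d := Quotient.map₂ (sa := S.retSetoid) (sb := S.retSetoid) (sc := S.retSetoid)
    (fun x y => S.σ x y) (fun _ _ hx _ _ hy => S.ret_σ hx hy) c d
  invFun d := Quotient.map₂ (sa := S.retSetoid) (sb := S.retSetoid) (sc := S.retSetoid)
    (fun x y => (S.σ x).symm y) (fun _ _ hx _ _ hy => S.ret_σ_symm hx hy) c d
  left_inv d := by
    induction c, d using Quotient.inductionOn₂ with | h x y
    exact congrArg (Quotient.mk S.retSetoid) ((S.σ x).symm_apply_apply y)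
  right_inv d := by
    induction c, d using Quotient.inductionOn₂ with | h x y
    exact congrArg (Quotient.mk S.retSetoid) ((S.σ x).apply_symm_apply y)

/-- The permutation `[y] ↦ [τ_x(y)]` of `X/∼`, for a class `c = [x]`. -/
def retτ (S : YBSolution X) (c : S.RetType) : Equiv.Perm S.RetType where
  toFun d := Quotient.map₂ (sa := S.retSetoid) (sb := S.retSetoid) (sc := S.retSetoid)
    (fun x y => S.τ x y) (fun _ _ hx _ _ hy => S.ret_τ hy hx) c d
  invFun d := Quotient.map₂ (sa := S.retSetoid) (sb := S.retSetoid) (sc := S.retSetoid)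
    (fun x y => (S.τ x).symm y) (fun _ _ hx _ _ hy => S.ret_τ_symm hx hy) c d
  left_inv d := by
    induction c, d using Quotient.inductionOn₂ with | h x y
    exact congrArg (Quotient.mk S.retSetoid) ((S.τ x).symm_apply_apply y)
  right_inv d := by
    induction c, d using Quotient.inductionOn₂ with | h x y
    exact congrArg (Quotient.mk S.retSetoid) ((S.τ x).apply_symm_apply y)

/-- The retraction `Ret(X)`: the solution on `X/∼` with
`σ_[x]([y]) = [σ_x(y)]` and `τ_[y]([x]) = [τ_y(x)]`. -/
def ret (S : YBSolution X) : YBSolution S.RetType where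
  σ := S.retσ
  τ := S.retτ
  braid := by
    rintro ⟨a, b, c⟩
    induction a, b, c using Quotient.inductionOn₃ with | h x y z
    exact Prod.ext (congrArg (Quotient.mk S.retSetoid) (S.braid_fst x y z))
      (Prod.ext (congrArg (Quotient.mk S.retSetoid) (S.braid_snd x y z))
        (congrArg (Quotient.mk S.retSetoid) (S.braid_thd x y z)))
  involutive := by
    rintro ⟨a, b⟩
    induction a, b using Quotient.inductionOn₂ with | h x y
    exact Prod.ext (congrArg (Quotient.mk S.retSetoid) (S.inv_fst x y))
      (congrArg (Quotient.mk S.retSetoid) (S.inv_snd x y))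

/-- A permutation solution (multipermutation level `1`): `|Ret(X)| = 1`. -/
def IsPermutationSolution (S : YBSolution X) : Prop :=
  Nat.card S.RetType = 1

/-- Multipermutation level `2`: not a permutation solution, and `|Ret(Ret(X))| = 1`. -/
def IsLevelTwo (S : YBSolution X) : Prop :=
  ¬ S.IsPermutationSolution ∧ Nat.card S.ret.RetType = 1

/-- The permutation group `𝒢(X) = ⟨σ_x : x ∈ X⟩`. -/
def permGroup (S : YBSolution X) : Subgroup (Equiv.Perm X) :=
  Subgroup.closure (Set.range S.σ)

/-- The displacement group `Dis(X) = ⟨σ_x σ_y⁻¹ : x, y ∈ X⟩`. -/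
def dis (S : YBSolution X) : Subgroup (Equiv.Perm X) :=
  Subgroup.closure {g | ∃ x y : X, g = S.σ x * (S.σ y)⁻¹}

/-- Indecomposable: the permutation group acts transitively on `X`. -/
def IsIndecomposable (S : YBSolution X) : Prop :=
  MulAction.IsPretransitive S.permGroup X

/-- `Dis(X)_e` is normal in `Dis(X)` and `Dis(X)/Dis(X)_e ≅ A`. -/
def DisQuotientIso (S : YBSolution X) (e : X) (A : Type v) [AddCommGroup A] : Prop :=
  ∃ _ : (MulAction.stabilizer S.dis e).Normal,
    Nonempty ((S.dis ⧸ MulAction.stabilizer S.dis e) ≃* Multiplicative A)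

/-- The index `[𝒢(X) : 𝒢(X)_e Dis(X)]`, computed inside `𝒢(X)`. -/
noncomputable def disIndex (S : YBSolution X) (e : X) : ℕ :=
  (MulAction.stabilizer S.permGroup e ⊔ S.dis.subgroupOf S.permGroup).index

/-- Isomorphism of solutions: a bijection `Φ` with `Φ σ_x = σ'_{Φ(x)} Φ` for all `x`. -/
def Isomorphic (S T : Σ X : Type u, YBSolution X) : Prop :=
  ∃ Φ : S.1 ≃ T.1, ∀ x y : S.1, Φ (S.2.σ x y) = T.2.σ (Φ x) (Φ y)

/-- Isomorphism of solutions, as an equivalence relation on all solutions. -/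
def isoSetoid : Setoid (Σ X : Type u, YBSolution X) where
  r := Isomorphic
  iseqv :=
    { refl := fun _ => ⟨Equiv.refl _, fun _ _ => rfl⟩
      symm := fun {S T} ⟨Φ, h⟩ => ⟨Φ.symm, fun x y => by
        rw [Equiv.symm_apply_eq, h, Equiv.apply_symm_apply, Equiv.apply_symm_apply]⟩
      trans := fun ⟨Φ, h⟩ ⟨Ψ, h'⟩ => ⟨Φ.trans Ψ, fun x y => by
        simp only [Equiv.trans_apply, h, h']⟩ }

/-- The isomorphism classes of indecomposable solutions of multipermutation level `2` with
`Dis(X)/Dis(X)_e ≅ A` and `[𝒢(X) : 𝒢(X)_e Dis(X)] = m`, for `e ∈ X`. -/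
def classes (A : Type v) [AddCommGroup A] (m : ℕ) : Set (Quotient isoSetoid.{u}) :=
  {c | ∃ (X : Type u) (S : YBSolution X), Quotient.mk isoSetoid.{u} ⟨X, S⟩ = c ∧
    S.IsIndecomposable ∧ S.IsLevelTwo ∧ ∀ e : X, S.DisQuotientIso e A ∧ S.disIndex e = m}

end YBSolution

/-! Level `2` makes `σ_(σ_x(z))` independent of `x`. The braid relation then forces `Dis(X)` to be
abelian and normal in `𝒢(X)`, makes `σ` constant on `Dis(X)`-orbits, and gives `𝒢(X) = Dis(X)⟨σ_e⟩`.
For indecomposable `X` the orbits of `Dis(X)` are therefore permuted cyclically by `σ_e`; there are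
`m` of them, and each is a torsor under `A`. The coordinates `(a, j) ↦ σ_e^j(a · e)` identify `X`
with `A × ℤ/m` carrying the structure `cyclicExt h w`, where `h(i) ∈ A` is the class of `σ_x σ_e⁻¹`
for `x = σ_e^i(e)`. Thus `h(0) = 0`, and the values of `h` generate `A`
(`exists_isomorphic_cyclicExt`).

For `A = ℤ/p^k`, generating means that some value of `h` is a unit, and every such `h` occurs.
Changing the origins of the fibres alters `w` by a coboundary, so only `t = ∑ w` matters, and
isomorphism amounts to multiplying `(h, t)` by a common unit (`cyclicExt_isomorphic_of_units`,
`exists_units_of_cyclicExt_isomorphic`).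

The unit group acts freely on these pairs, so the number of classes is `p^k (p^(k(m-1)) -
p^((k-1)(m-1)))` divided by `p^(k-1) (p - 1)`. -/

namespace YBSolution

/-! ### The model solutions on `A × ℤ/m` and their permutations. -/

section Model

variable {A : Type} [AddCommGroup A] {m : ℕ}

/-- The solution on `A × ℤ/m` with `σ_(b,i)(a,j) = (a + h(i - j - 1) + w(j), j + 1)`. -/
def cyclicExt (h w : ZMod m → A) : YBSolution (ULift.{u} (A × ZMod m)) where
  σ x :=
    { toFun := fun y => ⟨(y.down.1 + h (x.down.2 - y.down.2 - 1) + w y.down.2, y.down.2 + 1)⟩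
      invFun := fun y => ⟨(y.down.1 - h (x.down.2 - y.down.2) - w (y.down.2 - 1), y.down.2 - 1)⟩
      left_inv := by
        rintro ⟨a, j⟩
        simp [sub_sub]
      right_inv := by
        rintro ⟨a, j⟩
        simp only [sub_add_cancel, show x.down.2 - (j - 1) - 1 = x.down.2 - j by ring]
        simp only [ULift.up.injEq, Prod.mk.injEq, and_true]
        abel }
  τ y :=
    { toFun := fun x => ⟨(x.down.1 - h (y.down.2 + 1 - x.down.2) - w (x.down.2 - 1),
        x.down.2 - 1)⟩
      invFun := fun x => ⟨(x.down.1 + h (y.down.2 - x.down.2) + w x.down.2, x.down.2 + 1)⟩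
      left_inv := by
        rintro ⟨a, j⟩
        simp only [sub_add_cancel, sub_sub_eq_add_sub, ULift.up.injEq, Prod.mk.injEq, and_true]
        abel
      right_inv := by
        rintro ⟨a, j⟩
        simp only [add_sub_cancel_right, add_sub_add_right_eq_sub, ULift.up.injEq,
          Prod.mk.injEq, and_true]
        abel }
  braid := by
    rintro ⟨⟨⟨a, i⟩⟩, ⟨⟨b, j⟩⟩, ⟨⟨c, l⟩⟩⟩
    simp only [ybSnd, ybFst, ybMap, Equiv.coe_fn_mk, Prod.mk.injEq, ULift.up.injEq]
    ring_nf
    refine ⟨⟨?_, trivial⟩, ⟨?_, trivial⟩, ⟨?_, trivial⟩⟩ <;> abel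
  involutive := by
    rintro ⟨⟨⟨a, i⟩⟩, ⟨⟨b, j⟩⟩⟩
    simp only [ybMap, Equiv.coe_fn_mk, Prod.mk.injEq, ULift.up.injEq]
    ring_nf
    refine ⟨⟨?_, trivial⟩, ⟨?_, trivial⟩⟩ <;> abel

variable (h w : ZMod m → A)

theorem cyclicExt_σ_apply (x : ULift.{u} (A × ZMod m)) (a : A) (j : ZMod m) :
    (cyclicExt h w).σ x ⟨(a, j)⟩ = ⟨(a + h (x.down.2 - j - 1) + w j, j + 1)⟩ := rfl

theorem cyclicExt_σ_inv_apply (x : ULift.{u} (A × ZMod m)) (a : A) (j : ZMod m) :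
    ((cyclicExt h w).σ x)⁻¹ ⟨(a, j)⟩ =
      ⟨(a - h (x.down.2 - j) - w (j - 1), j - 1)⟩ := rfl

/-- The contribution of `w` cancels, so displacements see only differences of values of `h`. -/
theorem cyclicExt_σ_mul_inv_apply (x y : ULift.{u} (A × ZMod m)) (a : A) (j : ZMod m) :
    ((cyclicExt h w).σ x * ((cyclicExt h w).σ y)⁻¹) ⟨(a, j)⟩ =
      ⟨(a + (h (x.down.2 - j) - h (y.down.2 - j)), j)⟩ := by
  rw [Equiv.Perm.mul_apply, cyclicExt_σ_inv_apply, cyclicExt_σ_apply]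
  simp only [ULift.up.injEq, Prod.mk.injEq, sub_add_cancel, and_true]
  ring_nf
  abel

theorem cyclicExt_σ_congr {x y : ULift.{u} (A × ZMod m)} (hxy : x.down.2 = y.down.2) :
    (cyclicExt h w).σ x = (cyclicExt h w).σ y := by
  ext z : 1
  obtain ⟨⟨a, j⟩⟩ := z
  rw [cyclicExt_σ_apply, cyclicExt_σ_apply, hxy]

theorem cyclicExt_σ_pow_apply (x : ULift.{u} (A × ZMod m)) (l : ℕ) (a : A) (j : ZMod m) :
    ((cyclicExt h w).σ x ^ l) ⟨(a, j)⟩ =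
      ⟨(a + ∑ r ∈ Finset.range l, (h (x.down.2 - (j + r) - 1) + w (j + r)), j + l)⟩ := by
  induction l with
  | zero => simp
  | succ l ih =>
    rw [pow_succ', Equiv.Perm.mul_apply, ih, cyclicExt_σ_apply, Finset.sum_range_succ]
    simp only [ULift.up.injEq, Prod.mk.injEq]
    push_cast
    constructor <;> abel

theorem sum_range_natCast_zmod [NeZero m] (f : ZMod m → A) :
    ∑ r ∈ Finset.range m, f (r : ZMod m) = ∑ i, f i := by
  refine Finset.sum_bij' (fun r _ => (r : ZMod m)) (fun i _ => i.val) (by simp)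
    (fun i _ => Finset.mem_range.2 (ZMod.val_lt i))
    (fun r hr => ZMod.val_cast_of_lt (Finset.mem_range.1 hr)) (fun i _ => by simp) (by simp)

/-- Going once around `ℤ/m` meets every value of `h` and `w` exactly once. The resulting translation
depends on neither `x` nor `j`, and it is the invariant that recovers `∑ w`. -/
theorem cyclicExt_σ_pow_card_apply [NeZero m] (x : ULift.{u} (A × ZMod m)) (a : A) (j : ZMod m) :
    ((cyclicExt h w).σ x ^ m) ⟨(a, j)⟩ = ⟨(a + (∑ i, h i + ∑ i, w i), j)⟩ := by
  rw [cyclicExt_σ_pow_apply]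
  simp only [CharP.cast_eq_zero, add_zero, ULift.up.injEq, Prod.mk.injEq, and_true,
    add_right_inj]
  rw [sum_range_natCast_zmod (fun r => h (x.down.2 - (j + r) - 1) + w (j + r)),
    Finset.sum_add_distrib]
  congr 1
  · refine Fintype.sum_equiv (Equiv.subLeft (x.down.2 - j - 1)) _ _ fun r => ?_
    simp only [Equiv.subLeft_apply]
    congr 1
    ring
  · exact Fintype.sum_equiv (Equiv.addLeft j) _ _ fun r => rfl

/-- Elements of the displacement group translate each fibre over `ℤ/m`. -/
theorem cyclicExt_dis_apply {d : Equiv.Perm (ULift.{u} (A × ZMod m))}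
    (hd : d ∈ (cyclicExt h w).dis) :
    ∃ c : ZMod m → A, ∀ a j, d ⟨(a, j)⟩ = ⟨(a + c j, j)⟩ := by
  induction hd using Subgroup.closure_induction with
  | mem d hd =>
    obtain ⟨x, y, rfl⟩ := hd
    exact ⟨_, fun a j => cyclicExt_σ_mul_inv_apply h w x y a j⟩
  | one => exact ⟨0, fun a j => by simp⟩
  | mul d d' _ _ hd hd' =>
    obtain ⟨c, hc⟩ := hd
    obtain ⟨c', hc'⟩ := hd'
    exact ⟨c' + c, fun a j => by simp [hc, hc', add_assoc]⟩
  | inv d _ hd =>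
    obtain ⟨c, hc⟩ := hd
    exact ⟨-c, fun a j => by rw [Equiv.Perm.inv_eq_iff_eq, hc]; simp⟩

/-- Elements of the permutation group shift the index in `ℤ/m` by a constant. -/
theorem cyclicExt_permGroup_apply {g : Equiv.Perm (ULift.{u} (A × ZMod m))}
    (hg : g ∈ (cyclicExt h w).permGroup) :
    ∃ c : ZMod m, ∀ x, (g x).down.2 = x.down.2 + c := by
  induction hg using Subgroup.closure_induction with
  | mem g hg =>
    obtain ⟨x, rfl⟩ := hg
    exact ⟨1, fun y => rfl⟩
  | one => exact ⟨0, fun x => by simp⟩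
  | mul g g' _ _ hg hg' =>
    obtain ⟨c, hc⟩ := hg
    obtain ⟨c', hc'⟩ := hg'
    exact ⟨c' + c, fun x => by simp [hc, hc', add_assoc]⟩
  | inv g _ hg =>
    obtain ⟨c, hc⟩ := hg
    refine ⟨-c, fun x => ?_⟩
    have := hc (g⁻¹ x)
    rw [← Equiv.Perm.mul_apply, mul_inv_cancel, Equiv.Perm.one_apply] at this
    rw [this, add_neg_cancel_right]

theorem dis_le_permGroup {X : Type u} (S : YBSolution X) : S.dis ≤ S.permGroup := by
  refine (Subgroup.closure_le _).2 ?_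
  rintro _ ⟨x, y, rfl⟩
  exact mul_mem (Subgroup.subset_closure ⟨x, rfl⟩) (inv_mem (Subgroup.subset_closure ⟨y, rfl⟩))

theorem σ_mul_inv_mem_dis {X : Type u} (S : YBSolution X) (x y : X) :
    S.σ x * (S.σ y)⁻¹ ∈ S.dis :=
  Subgroup.subset_closure ⟨x, y, rfl⟩

theorem σ_mem_permGroup {X : Type u} (S : YBSolution X) (x : X) : S.σ x ∈ S.permGroup :=
  Subgroup.subset_closure ⟨x, rfl⟩

end Model

/-! ### The models satisfy all the required conditions. -/

section Membership

variable {n m : ℕ} (h w : ZMod m → ZMod n)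

/-- The displacement group acts transitively on each fibre over `ℤ/m`. -/
theorem cyclicExt_dis_transitive (h0 : h 0 = 0) (hu : ∃ i, IsUnit (h i)) (a b : ZMod n)
    (j : ZMod m) :
    ∃ d ∈ (cyclicExt.{u} h w).dis, d ⟨(a, j)⟩ = ⟨(b, j)⟩ := by
  obtain ⟨i, v, hv⟩ := hu
  let x : ULift.{u} (ZMod n × ZMod m) := ⟨(0, i + j)⟩
  let y : ULift.{u} (ZMod n × ZMod m) := ⟨(0, j)⟩
  let d := (cyclicExt h w).σ x * ((cyclicExt h w).σ y)⁻¹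
  have hd : ∀ c, d ⟨(c, j)⟩ = ⟨(c + v, j)⟩ := fun c => by
    rw [cyclicExt_σ_mul_inv_apply]
    simp [x, y, h0, hv]
  have hdl : ∀ (l : ℕ) c, (d ^ l) ⟨(c, j)⟩ = ⟨(c + l * v, j)⟩ := fun l => by
    induction l with
    | zero => simp
    | succ l ih =>
      intro c
      rw [pow_succ', Equiv.Perm.mul_apply, ih, hd]
      push_cast
      simp only [ULift.up.injEq, Prod.mk.injEq, and_true]
      ring
  -- `d` translates fibre `j` by the unit `v`, so the exponent is an integer lift of `(b - a) / v`.
  obtain ⟨l, hl⟩ := ZMod.intCast_surjective ((b - a) * ((v⁻¹ : (ZMod n)ˣ) : ZMod n))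
  have hdz : ∀ c, (d ^ l) ⟨(c, j)⟩ = ⟨(c + l * v, j)⟩ := fun c => by
    obtain ⟨k, rfl | rfl⟩ := l.eq_nat_or_neg
    · simpa using hdl k c
    · rw [zpow_neg, zpow_natCast, Equiv.Perm.inv_eq_iff_eq, hdl]
      simp
  refine ⟨d ^ l, zpow_mem (σ_mul_inv_mem_dis _ x y) l, ?_⟩
  rw [hdz, hl]
  simp

theorem cyclicExt_isIndecomposable [NeZero m] (h0 : h 0 = 0) (hu : ∃ i, IsUnit (h i)) :
    (cyclicExt.{u} h w).IsIndecomposable := by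
  refine ⟨?_⟩
  rintro ⟨⟨a, i⟩⟩ ⟨⟨b, j⟩⟩
  let x : ULift.{u} (ZMod n × ZMod m) := ⟨(0, 0)⟩
  have hs := cyclicExt_σ_pow_apply h w x (j - i).val a i
  rw [ZMod.natCast_val, ZMod.cast_id', id, add_sub_cancel] at hs
  obtain ⟨d, hd, hd'⟩ := cyclicExt_dis_transitive h w h0 hu _ b j
  refine ⟨⟨d * (cyclicExt h w).σ x ^ (j - i).val,
    mul_mem (dis_le_permGroup _ hd) (pow_mem (σ_mem_permGroup _ x) _)⟩, ?_⟩
  change (d * _) _ = _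
  rw [Equiv.Perm.mul_apply, hs, hd']

theorem isPermutationSolution_iff {X : Type u} [Nonempty X] (S : YBSolution X) :
    S.IsPermutationSolution ↔ ∀ x y, S.σ x = S.σ y := by
  have hne : Nonempty S.RetType := ‹Nonempty X›.map (Quotient.mk S.retSetoid)
  rw [IsPermutationSolution, Nat.card_eq_one_iff_unique, and_iff_left hne]
  constructor
  · intro hs x y
    exact S.τ_eq_iff_σ_eq.1 (Quotient.exact (s := S.retSetoid)
      (hs.elim (Quotient.mk S.retSetoid x) (Quotient.mk S.retSetoid y)))
  · intro hs
    refine ⟨fun c d => ?_⟩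
    induction c, d using Quotient.inductionOn₂ with | h x y
    exact Quotient.sound (s := S.retSetoid) (S.τ_eq_iff_σ_eq.2 (hs x y))

theorem ret_isPermutationSolution_iff {X : Type u} [Nonempty X] (S : YBSolution X) :
    S.ret.IsPermutationSolution ↔ ∀ x y z, S.σ (S.σ x z) = S.σ (S.σ y z) := by
  have hne : Nonempty S.RetType := ‹Nonempty X›.map (Quotient.mk S.retSetoid)
  rw [isPermutationSolution_iff]
  constructor
  · intro hs x y z
    have := DFunLike.congr_fun (hs (Quotient.mk S.retSetoid x) (Quotient.mk S.retSetoid y))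
      (Quotient.mk S.retSetoid z)
    exact S.τ_eq_iff_σ_eq.1 (Quotient.exact (s := S.retSetoid) this)
  · intro hs c d
    ext e
    induction c, d, e using Quotient.inductionOn₃ with | h x y z
    exact Quotient.sound (s := S.retSetoid) (S.τ_eq_iff_σ_eq.2 (hs x y z))

theorem cyclicExt_isLevelTwo [Fact (1 < n)] (h0 : h 0 = 0) (hu : ∃ i, IsUnit (h i)) :
    (cyclicExt.{u} h w).IsLevelTwo := by
  constructor
  · rw [isPermutationSolution_iff]
    obtain ⟨i, hi⟩ := hu
    intro hs
    have h1 := congrArg (fun z => (z ⟨(0, 0)⟩ : ULift.{u} (ZMod n × ZMod m)))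
      (mul_inv_eq_one.2 (hs ⟨(0, i)⟩ ⟨(0, 0)⟩))
    simp only [cyclicExt_σ_mul_inv_apply] at h1
    simp [h0] at h1
    exact hi.ne_zero h1
  · change (cyclicExt.{u} h w).ret.IsPermutationSolution
    rw [ret_isPermutationSolution_iff]
    exact fun x y z => cyclicExt_σ_congr h w rfl

theorem cyclicExt_disQuotientIso {A : Type v} [AddCommGroup A] (φ : ZMod n ≃+ A)
    (h0 : h 0 = 0) (hu : ∃ i, IsUnit (h i)) (e : ULift.{u} (ZMod n × ZMod m)) :
    (cyclicExt.{u} h w).DisQuotientIso e A := by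
  obtain ⟨⟨a, j⟩⟩ := e
  -- Displacements translate each fibre, so evaluation at one point of fibre `j` is a homomorphism,
  -- and its kernel fixes every point of that fibre.
  let f : (cyclicExt.{u} h w).dis →* Multiplicative A :=
    { toFun := fun d => .ofAdd (φ (d.1 ⟨(0, j)⟩).down.1)
      map_one' := by simp
      map_mul' := fun d d' => by
        obtain ⟨c, hc⟩ := cyclicExt_dis_apply h w d.2
        obtain ⟨c', hc'⟩ := cyclicExt_dis_apply h w d'.2
        simp [hc, hc', ← ofAdd_add, add_comm] }
  have hf : f.ker = MulAction.stabilizer (cyclicExt.{u} h w).dis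
      (⟨(a, j)⟩ : ULift.{u} (ZMod n × ZMod m)) := by
    ext d
    obtain ⟨c, hc⟩ := cyclicExt_dis_apply h w d.2
    rw [MonoidHom.mem_ker, MulAction.mem_stabilizer_iff]
    change Multiplicative.ofAdd (φ (d.1 ⟨(0, j)⟩).down.1) = 1 ↔
      d.1 ⟨(a, j)⟩ = _
    simp [hc]
  have hs : Function.Surjective f := by
    intro b
    obtain ⟨d, hd, hd'⟩ := cyclicExt_dis_transitive h w h0 hu 0 (φ.symm b.toAdd) j
    refine ⟨⟨d, hd⟩, ?_⟩
    change Multiplicative.ofAdd (φ (d ⟨(0, j)⟩).down.1) = b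
    simp [hd']
  rw [DisQuotientIso, ← hf]
  exact ⟨inferInstance, ⟨QuotientGroup.quotientKerEquivOfSurjective f hs⟩⟩

theorem cyclicExt_disIndex [NeZero m] (h0 : h 0 = 0) (hu : ∃ i, IsUnit (h i))
    (e : ULift.{u} (ZMod n × ZMod m)) : (cyclicExt.{u} h w).disIndex e = m := by
  let f : (cyclicExt.{u} h w).permGroup →* Multiplicative (ZMod m) :=
    { toFun := fun g => .ofAdd ((g : Equiv.Perm _) e).down.2 / .ofAdd e.down.2
      map_one' := by simp
      map_mul' := fun g g' => by
        obtain ⟨c, hc⟩ := cyclicExt_permGroup_apply h w g.2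
        obtain ⟨c', hc'⟩ := cyclicExt_permGroup_apply h w g'.2
        simp only [Subgroup.coe_mul, Equiv.Perm.mul_apply, hc, hc', ← ofAdd_add, ← ofAdd_sub]
        congr 1
        abel }
  have hfe : ∀ g, f g = .ofAdd (((g : Equiv.Perm _) e).down.2 - e.down.2) := fun g => rfl
  -- An element preserving the fibre of `e` can be corrected by a displacement so as to fix `e`.
  have hf : f.ker = MulAction.stabilizer (cyclicExt.{u} h w).permGroup e ⊔
      (cyclicExt.{u} h w).dis.subgroupOf (cyclicExt.{u} h w).permGroup := by
    apply le_antisymm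
    · intro g hg
      rw [MonoidHom.mem_ker, hfe, ofAdd_eq_one, sub_eq_zero] at hg
      obtain ⟨d, hd, hd'⟩ := cyclicExt_dis_transitive h w h0 hu
        ((g : Equiv.Perm _) e).down.1 e.down.1 e.down.2
      have hge : (g : Equiv.Perm _) e = ⟨(((g : Equiv.Perm _) e).down.1, e.down.2)⟩ := by
        rw [← hg]
      rw [← hge] at hd'
      let d' : (cyclicExt.{u} h w).permGroup := ⟨d, dis_le_permGroup _ hd⟩
      have : g = d'⁻¹ * (d' * g) := by group
      rw [this]
      refine mul_mem (inv_mem (Subgroup.mem_sup_right hd)) (Subgroup.mem_sup_left ?_)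
      exact hd'
    · refine sup_le ?_ ?_
      · intro g hg
        have hg' : (g : Equiv.Perm _) e = e := hg
        rw [MonoidHom.mem_ker, hfe, hg', sub_self, ofAdd_zero]
      · intro g hg
        obtain ⟨c, hc⟩ := cyclicExt_dis_apply h w hg
        have hge : (g : Equiv.Perm _) e = _ := hc e.down.1 e.down.2
        rw [MonoidHom.mem_ker, hfe, hge, sub_self, ofAdd_zero]
  have hs : Function.Surjective f := by
    intro b
    refine ⟨⟨(cyclicExt h w).σ e ^ b.toAdd.val, pow_mem (σ_mem_permGroup _ e) _⟩, ?_⟩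
    rw [hfe]
    change Multiplicative.ofAdd
      ((((cyclicExt h w).σ e ^ b.toAdd.val) ⟨(e.down.1, e.down.2)⟩).down.2 - e.down.2) = b
    rw [cyclicExt_σ_pow_apply]
    simp
  rw [disIndex, ← hf, Subgroup.index_ker, MonoidHom.range_eq_top.2 hs]
  simp

end Membership

/-! ### Isomorphisms between models. -/

section Isomorphism

theorem periodic_apply_val_intCast {α : Type*} {m : ℕ} [NeZero m] {F : ℤ → α}
    (hF : Function.Periodic F m) (l : ℤ) : F ((l : ZMod m).val : ℤ) = F l := by
  rw [ZMod.val_intCast, Int.emod_def, mul_comm]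
  simpa using hF.sub_zsmul_eq (n := l / m) (x := l)

theorem val_add_one_of_add_one_ne_zero {m : ℕ} [NeZero m] {j : ZMod m} (hj : j + 1 ≠ 0) :
    (j + 1).val = j.val + 1 := by
  have h1 : j + 1 = ((j.val + 1 : ℕ) : ZMod m) := by simp
  have h2 := ZMod.val_lt j
  rcases (Nat.succ_le_of_lt h2).lt_or_eq with h3 | h3
  · rw [h1, ZMod.val_cast_of_lt h3]
  · rw [h1, show j.val + 1 = m from h3, ZMod.natCast_self] at hj
    exact absurd rfl hj

theorem val_add_one_eq_of_add_one_eq_zero {m : ℕ} [NeZero m] {j : ZMod m} (hj : j + 1 = 0) :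
    j.val + 1 = m := by
  have h1 : ((j.val + 1 : ℕ) : ZMod m) = 0 := by simpa using hj
  have h2 := Nat.le_of_dvd (by omega) ((ZMod.natCast_eq_zero_iff _ _).1 h1)
  have h3 := ZMod.val_lt j
  omega

/-- A function on `ℤ/m` with vanishing sum is a coboundary. -/
theorem exists_sub_eq_of_sum_eq_zero {A : Type} [AddCommGroup A] {m : ℕ} [NeZero m]
    (f : ZMod m → A) (hf : ∑ i, f i = 0) : ∃ q : ZMod m → A, ∀ j, q (j + 1) = q j + f j := by
  refine ⟨fun j => ∑ r ∈ Finset.range j.val, f (r : ZMod m), fun j => ?_⟩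
  have hs : ∑ r ∈ Finset.range (j.val + 1), f (r : ZMod m) =
      ∑ r ∈ Finset.range j.val, f (r : ZMod m) + f j := by
    rw [Finset.sum_range_succ, ZMod.natCast_zmod_val]
  simp only
  rw [← hs]
  by_cases hj : j + 1 = 0
  · rw [val_add_one_eq_of_add_one_eq_zero hj, hj, sum_range_natCast_zmod, hf]
    simp
  · rw [val_add_one_of_add_one_ne_zero hj]

variable {n m : ℕ} [NeZero m] {h h' w w' : ZMod m → ZMod n}

/-- The isomorphism is `(a, j) ↦ (u a + q(j), j)`, which requires `q(j+1) - q(j) = w'(j) - u w(j)`;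
this is solvable because the right side sums to zero. -/
theorem cyclicExt_isomorphic_of_units (u : (ZMod n)ˣ) (hh : ∀ i, u * h i = h' i)
    (hw : u * ∑ i, w i = ∑ i, w' i) :
    Isomorphic.{u} ⟨_, cyclicExt h w⟩ ⟨_, cyclicExt h' w'⟩ := by
  obtain ⟨q, hq⟩ := exists_sub_eq_of_sum_eq_zero (fun j => w' j - u * w j)
    (by rw [Finset.sum_sub_distrib, ← Finset.mul_sum, hw, sub_self])
  refine ⟨⟨fun x => ⟨(u * x.down.1 + q x.down.2, x.down.2)⟩,
    fun x => ⟨((u⁻¹ : (ZMod n)ˣ) * (x.down.1 - q x.down.2), x.down.2)⟩, ?_, ?_⟩, ?_⟩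
  · rintro ⟨⟨a, i⟩⟩
    simp
  · rintro ⟨⟨a, i⟩⟩
    simp
  · rintro ⟨⟨b, i⟩⟩ ⟨⟨a, j⟩⟩
    change (ULift.up (_, _) : ULift.{u} (ZMod n × ZMod m)) = ULift.up (_, _)
    simp only [Equiv.coe_fn_mk, ULift.up.injEq, Prod.mk.injEq, cyclicExt_σ_apply, and_true, hq,
      ← hh]
    ring

/-- An isomorphism intertwines the displacements `σ_x σ_y⁻¹`, which determine `h`, and the powers
`σ_x^m`, which then determine `∑ w`. -/
theorem exists_units_of_cyclicExt_isomorphic [NeZero n] (h0 : h 0 = 0) (h0' : h' 0 = 0)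
    (hu : ∃ i, IsUnit (h i)) (hiso : Isomorphic.{u} ⟨_, cyclicExt h w⟩ ⟨_, cyclicExt h' w'⟩) :
    ∃ u : (ZMod n)ˣ, (∀ i, u * h i = h' i) ∧ u * ∑ i, w i = ∑ i, w' i := by
  obtain ⟨Φ, hΦ⟩ := hiso
  simp only at Φ hΦ
  have hinv : ∀ x y z, Φ (((cyclicExt h w).σ x * ((cyclicExt h w).σ y)⁻¹) z) =
      ((cyclicExt h' w').σ (Φ x) * ((cyclicExt h' w').σ (Φ y))⁻¹) (Φ z) := by
    intro x y z
    rw [Equiv.Perm.mul_apply, Equiv.Perm.mul_apply, hΦ]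
    congr 1
    rw [eq_comm, Equiv.Perm.inv_eq_iff_eq, ← hΦ]
    exact congrArg Φ (((cyclicExt h w).σ y).apply_symm_apply z).symm
  have hpow : ∀ (l : ℕ) x z, Φ (((cyclicExt h w).σ x ^ l) z) =
      ((cyclicExt h' w').σ (Φ x) ^ l) (Φ z) := by
    intro l x z
    induction l with
    | zero => simp
    | succ l ih => rw [pow_succ', pow_succ', Equiv.Perm.mul_apply, Equiv.Perm.mul_apply, hΦ, ih]
  obtain ⟨i, v, hv⟩ := hu
  obtain ⟨⟨b, c⟩, hbc⟩ : ∃ q : ZMod n × ZMod m, Φ ⟨(0, 0)⟩ = ⟨q⟩ := ⟨_, rfl⟩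
  -- `v'` is the translation in the target that corresponds to translation by the generator `v`;
  -- hence `Φ` is affine on fibre `0`, with slope `v' / v`.
  set v' : ZMod n := h' ((Φ ⟨(0, i)⟩).down.2 - c) with hv'
  have hmul : ∀ l : ℕ, Φ ⟨(l * v, 0)⟩ = ⟨(b + l * v', c)⟩ := by
    intro l
    induction l with
    | zero => simp [hbc]
    | succ l ih =>
      have := hinv ⟨(0, i)⟩ ⟨(0, 0)⟩ ⟨(l * v, 0)⟩
      rw [ih, cyclicExt_σ_mul_inv_apply, cyclicExt_σ_mul_inv_apply, hbc] at this
      simp only [sub_zero, h0, ← hv, sub_self, h0', ← hv'] at this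
      push_cast
      rw [add_mul, one_mul, this]
      simp only [ULift.up.injEq, Prod.mk.injEq, and_true]
      ring
  have hfib : ∀ a, Φ ⟨(a, 0)⟩ = ⟨(b + ((v⁻¹ : (ZMod n)ˣ) * v') * a, c)⟩ := by
    intro a
    have := hmul (a * (v⁻¹ : (ZMod n)ˣ)).val
    rw [ZMod.natCast_zmod_val, Units.inv_mul_cancel_right] at this
    rw [this]
    simp only [ULift.up.injEq, Prod.mk.injEq, and_true]
    ring
  set r : ZMod n := (v⁻¹ : (ZMod n)ˣ) * v' with hr
  -- Fibre `j` is the image of fibre `0` under the `j`-th power of one `σ`, and each `σ` raises the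
  -- index by one in both models.
  have hindex : ∀ x, (Φ x).down.2 = x.down.2 + c := by
    rintro ⟨⟨a, j⟩⟩
    obtain ⟨a', ha'⟩ : ∃ a', ((cyclicExt h w).σ ⟨(0, 0)⟩ ^ j.val) ⟨(a', 0)⟩ = ⟨(a, j)⟩ := by
      simp only [cyclicExt_σ_pow_apply, ZMod.natCast_zmod_val, zero_add]
      exact ⟨a - _, by rw [sub_add_cancel]⟩
    rw [← ha', hpow, hfib a', cyclicExt_σ_pow_apply, cyclicExt_σ_pow_apply]
    simp [add_comm]
  have hinj : Function.Injective (fun a => r * a) := by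
    intro a a' haa
    have := hfib a
    rw [show r * a = r * a' from haa, ← hfib a'] at this
    simpa using Φ.injective this
  have hunit : IsUnit r :=
    IsUnit.of_mul_eq_one _ (Finite.surjective_of_injective hinj 1).choose_spec
  obtain ⟨u, hu⟩ := hunit
  have hh : ∀ i, u * h i = h' i := by
    intro i
    have := hinv ⟨(0, i)⟩ ⟨(0, 0)⟩ ⟨(0, 0)⟩
    rw [hbc, cyclicExt_σ_mul_inv_apply, cyclicExt_σ_mul_inv_apply, hfib, hindex, ← hbc,
      hindex] at this
    simpa [h0, h0', ← hu] using this
  refine ⟨u, hh, ?_⟩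
  have := hpow m ⟨(0, 0)⟩ ⟨(0, 0)⟩
  rw [hbc, cyclicExt_σ_pow_card_apply, cyclicExt_σ_pow_card_apply, hfib, ← hu] at this
  simp only [ULift.up.injEq, Prod.mk.injEq, and_true, zero_add, add_right_inj, mul_add,
    Finset.mul_sum, hh] at this
  rw [Finset.mul_sum, this]

end Isomorphism

end YBSolution

/-- If `G / D` is generated by the image of `s`, a power of `s` lies in a subgroup `H` above `D`
exactly when the exponent is divisible by the index of `H`. -/
theorem Subgroup.zpow_mem_iff_index_dvd {G : Type*} [Group G] {D H : Subgroup G} [D.Normal]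
    (hDH : D ≤ H) {s : G} (hs : ∀ g : G, ∃ l : ℤ, ∃ d ∈ D, g = d * s ^ l) (j : ℤ) :
    s ^ j ∈ H ↔ (H.index : ℤ) ∣ j := by
  have hmk : ∀ g : G, ∃ l : ℤ, (g : G ⧸ D) = (s : G ⧸ D) ^ l := fun g => by
    obtain ⟨l, d, hd, rfl⟩ := hs g
    exact ⟨l, by rw [QuotientGroup.mk_mul, (QuotientGroup.eq_one_iff d).2 hd, one_mul,
      QuotientGroup.mk_zpow]⟩
  -- `G / D` is cyclic, so commutators lie in `D ≤ H`.
  have hH : H.Normal := by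
    refine ⟨fun x hx g => ?_⟩
    obtain ⟨k, hk⟩ := hmk x
    obtain ⟨l, hl⟩ := hmk g
    have hxg : x⁻¹ * (g * x * g⁻¹) ∈ D := by
      rw [← QuotientGroup.eq_one_iff]
      simp only [QuotientGroup.mk_mul, QuotientGroup.mk_inv, hk, hl]
      group
    have := mul_mem hx (hDH hxg)
    rwa [mul_inv_cancel_left] at this
  have hgen : ∀ y : G ⧸ H, y ∈ Subgroup.zpowers (s : G ⧸ H) := by
    intro y
    obtain ⟨g, rfl⟩ := QuotientGroup.mk_surjective y
    obtain ⟨l, d, hd, rfl⟩ := hs g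
    exact ⟨l, by simp [QuotientGroup.mk_mul, (QuotientGroup.eq_one_iff d).2 (hDH hd)]⟩
  -- For infinite index both the order of `s` and the index are `0` by convention, so the
  -- equivalence persists.
  rw [← QuotientGroup.eq_one_iff, QuotientGroup.mk_zpow, ← orderOf_dvd_iff_zpow_eq_one,
    orderOf_eq_card_of_forall_mem_zpowers hgen, Subgroup.index]

namespace YBSolution

/-! ### Structure of the displacement group when the retraction is a permutation solution. -/

section Displacement

variable {X : Type u} (S : YBSolution X)

/-- This is the braid relation at `(x, σ_x⁻¹(y))`, in a form symmetric in `x` and `y`. -/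
theorem σ_mul_σ_symm (x y : X) :
    S.σ x * S.σ ((S.σ x).symm y) = S.σ y * S.σ ((S.σ y).symm x) := by
  ext z
  have := S.braid_fst x ((S.σ x).symm y) z
  rwa [Equiv.apply_symm_apply, ← S.σ_symm_eq y x] at this

variable {S}

theorem σ_σ_congr (hS : S.ret.IsPermutationSolution) (x y z : X) : S.σ (S.σ x z) = S.σ (S.σ y z) :=
  haveI : Nonempty X := ⟨x⟩
  (ret_isPermutationSolution_iff S).1 hS x y z

theorem σ_σ_symm_congr (hS : S.ret.IsPermutationSolution)
    (x y z : X) : S.σ ((S.σ x).symm z) = S.σ ((S.σ y).symm z) := by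
  have : Nonempty S.RetType := ⟨Quotient.mk S.retSetoid x⟩
  have := DFunLike.congr_fun (congrArg Equiv.symm ((isPermutationSolution_iff S.ret).1 hS
    (Quotient.mk S.retSetoid x) (Quotient.mk S.retSetoid y))) (Quotient.mk S.retSetoid z)
  exact S.τ_eq_iff_σ_eq.1 (Quotient.exact (s := S.retSetoid) this)

theorem σ_mul_σ_symm' (hS : S.ret.IsPermutationSolution) (e x y : X) :
    S.σ x * S.σ ((S.σ e).symm y) = S.σ y * S.σ ((S.σ e).symm x) := by
  rw [σ_σ_symm_congr hS e x, σ_mul_σ_symm, σ_σ_symm_congr hS e y]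

theorem σ_mul_inv_commute (hS : S.ret.IsPermutationSolution) (e x y : X) :
    Commute (S.σ x * (S.σ e)⁻¹) (S.σ y * (S.σ e)⁻¹) := by
  -- Inserting this formula into the symmetric identity for `x, y` and cancelling leaves `σ_x σ_e⁻¹
  -- σ_y = σ_y σ_e⁻¹ σ_x`.
  have hP : ∀ z, S.σ ((S.σ e).symm z) = (S.σ e)⁻¹ * (S.σ z * S.σ ((S.σ e).symm e)) := fun z => by
    rw [σ_mul_σ_symm' hS e z e, inv_mul_cancel_left]
  have h1 := σ_mul_σ_symm' hS e x y
  rw [hP x, hP y, ← mul_assoc, ← mul_assoc, ← mul_assoc, ← mul_assoc] at h1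
  have h2 := mul_right_cancel h1
  rw [Commute, SemiconjBy, ← mul_assoc, ← mul_assoc, h2]

theorem dis_commute (hS : S.ret.IsPermutationSolution)
    {d d' : Equiv.Perm X} (hd : d ∈ S.dis) (hd' : d' ∈ S.dis) :
    d * d' = d' * d := by
  have hc : ∀ a ∈ {g | ∃ x y : X, g = S.σ x * (S.σ y)⁻¹},
      ∀ b ∈ {g | ∃ x y : X, g = S.σ x * (S.σ y)⁻¹}, a * b = b * a := by
    rintro _ ⟨x, y, rfl⟩ _ ⟨z, t, rfl⟩
    have : S.σ z * (S.σ t)⁻¹ = S.σ z * (S.σ y)⁻¹ * (S.σ t * (S.σ y)⁻¹)⁻¹ := by group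
    rw [this]
    exact (σ_mul_inv_commute hS y x z).mul_right (σ_mul_inv_commute hS y x t).inv_right
  have := Subgroup.isMulCommutative_closure hc
  exact congrArg Subtype.val (mul_comm' (⟨d, hd⟩ : Subgroup.closure _) ⟨d', hd'⟩)

theorem σ_dis_apply (hS : S.ret.IsPermutationSolution)
    {d : Equiv.Perm X} (hd : d ∈ S.dis) (x : X) : S.σ (d x) = S.σ x := by
  induction hd using Subgroup.closure_induction generalizing x with
  | mem d hd =>
    obtain ⟨y, z, rfl⟩ := hd
    have := σ_σ_congr hS y z ((S.σ z).symm x)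
    rwa [Equiv.apply_symm_apply] at this
  | one => rfl
  | mul d d' _ _ hd hd' => rw [Equiv.Perm.mul_apply, hd, hd']
  | inv d _ hd =>
    have := hd (d⁻¹ x)
    rwa [← Equiv.Perm.mul_apply, mul_inv_cancel, Equiv.Perm.one_apply, eq_comm] at this

theorem conj_σ_mul_inv (hS : S.ret.IsPermutationSolution)
    {g : Equiv.Perm X} (hg : g ∈ S.permGroup) (x y : X) :
    g * (S.σ x * (S.σ y)⁻¹) * g⁻¹ = S.σ (g x) * (S.σ (g y))⁻¹ := by
  induction hg using Subgroup.closure_induction generalizing x y with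
  | mem g hg =>
    obtain ⟨z, rfl⟩ := hg
    -- The right-hand factor does not involve `x`, so it cancels in the conjugate of `σ_x σ_y⁻¹`.
    have h1 : ∀ x, S.σ z * S.σ x = S.σ (S.σ z x) * S.σ ((S.σ z).symm z) := fun x => by
      have := σ_mul_σ_symm' hS z z (S.σ z x)
      rwa [Equiv.symm_apply_apply] at this
    have h2 : S.σ z * (S.σ x * (S.σ y)⁻¹) * (S.σ z)⁻¹ =
        (S.σ z * S.σ x) * (S.σ z * S.σ y)⁻¹ := by group
    rw [h2, h1, h1]
    group
  | one => simp
  | mul g g' _ _ hg hg' =>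
    rw [Equiv.Perm.mul_apply, Equiv.Perm.mul_apply, ← hg, ← hg']
    group
  | inv g _ hg =>
    have := hg (g⁻¹ x) (g⁻¹ y)
    rw [← Equiv.Perm.mul_apply, ← Equiv.Perm.mul_apply, mul_inv_cancel, Equiv.Perm.one_apply,
      Equiv.Perm.one_apply] at this
    rw [← this]
    group

theorem conj_mem_dis (hS : S.ret.IsPermutationSolution)
    {g d : Equiv.Perm X} (hg : g ∈ S.permGroup) (hd : d ∈ S.dis) :
    g * d * g⁻¹ ∈ S.dis := by
  induction hd using Subgroup.closure_induction with
  | mem d hd =>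
    obtain ⟨x, y, rfl⟩ := hd
    rw [conj_σ_mul_inv hS hg]
    exact σ_mul_inv_mem_dis S _ _
  | one => simp
  | mul d d' _ _ hd hd' =>
    have : g * (d * d') * g⁻¹ = (g * d * g⁻¹) * (g * d' * g⁻¹) := by group
    exact this ▸ mul_mem hd hd'
  | inv d _ hd =>
    have : g * d⁻¹ * g⁻¹ = (g * d * g⁻¹)⁻¹ := by group
    exact this ▸ inv_mem hd

theorem σ_zpow_mem_permGroup (S : YBSolution X) (e : X) (l : ℤ) : S.σ e ^ l ∈ S.permGroup :=
  zpow_mem (σ_mem_permGroup S e) l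

theorem exists_eq_dis_mul_zpow (hS : S.ret.IsPermutationSolution)
    (e : X) {g : Equiv.Perm X} (hg : g ∈ S.permGroup) :
    ∃ l : ℤ, ∃ d ∈ S.dis, g = d * S.σ e ^ l := by
  induction hg using Subgroup.closure_induction with
  | mem g hg =>
    obtain ⟨z, rfl⟩ := hg
    exact ⟨1, _, σ_mul_inv_mem_dis S z e, by group⟩
  | one => exact ⟨0, 1, one_mem _, by simp⟩
  | mul g g' _ _ hg hg' =>
    obtain ⟨l, d, hd, rfl⟩ := hg
    obtain ⟨l', d', hd', rfl⟩ := hg'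
    refine ⟨l + l', d * (S.σ e ^ l * d' * (S.σ e ^ l)⁻¹),
      mul_mem hd (conj_mem_dis hS (σ_zpow_mem_permGroup S e l) hd'), by group⟩
  | inv g _ hg =>
    obtain ⟨l, d, hd, rfl⟩ := hg
    refine ⟨-l, S.σ e ^ (-l) * d⁻¹ * (S.σ e ^ (-l))⁻¹,
      conj_mem_dis hS (σ_zpow_mem_permGroup S e (-l)) (inv_mem hd), by group⟩

/-- The point `σ_e ^ j (e)` lies in the orbit of `e` under the displacement group exactly when
the index `[𝒢(X) : 𝒢(X)_e Dis(X)]` divides `j`. -/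
theorem zpow_apply_mem_orbit_iff (hS : S.ret.IsPermutationSolution) (e : X) (j : ℤ) :
    (∃ d ∈ S.dis, (S.σ e ^ j) e = d e) ↔ (S.disIndex e : ℤ) ∣ j := by
  let s : S.permGroup := ⟨S.σ e, σ_mem_permGroup S e⟩
  have hN : (S.dis.subgroupOf S.permGroup).Normal :=
    ⟨fun d hd g => conj_mem_dis hS g.2 hd⟩
  rw [disIndex, ← Subgroup.zpow_mem_iff_index_dvd (D := S.dis.subgroupOf S.permGroup)
    (s := s) le_sup_right]
  · rw [sup_comm, ← SetLike.mem_coe, Subgroup.normal_mul, Set.mem_mul]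
    constructor
    · rintro ⟨d, hd, hde⟩
      refine ⟨⟨d, dis_le_permGroup S hd⟩, hd, ⟨d, dis_le_permGroup S hd⟩⁻¹ * s ^ j, ?_,
        mul_inv_cancel_left _ _⟩
      change d⁻¹ ((S.σ e ^ j) e) = e
      rw [hde, ← Equiv.Perm.mul_apply, inv_mul_cancel, Equiv.Perm.one_apply]
    · rintro ⟨d, hd, g, hg, hdg⟩
      refine ⟨d, hd, ?_⟩
      have h1 : S.σ e ^ j = d.1 * g.1 := (congrArg Subtype.val hdg).symm
      have h2 : g.1 e = e := hg
      rw [h1, Equiv.Perm.mul_apply, h2]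
  · rintro ⟨g, hg⟩
    obtain ⟨l, d, hd, rfl⟩ := exists_eq_dis_mul_zpow hS e hg
    exact ⟨l, ⟨d, dis_le_permGroup S hd⟩, hd, rfl⟩

end Displacement

/-! ### Coordinates on an arbitrary solution of the given type. -/

section Classification

variable {X : Type u} {S : YBSolution X}

theorem exists_zpow_apply_eq (hS : S.ret.IsPermutationSolution) (hI : S.IsIndecomposable)
    (e x : X) : ∃ l : ℤ, ∃ d ∈ S.dis, x = (S.σ e ^ l) (d e) := by
  obtain ⟨g, hg⟩ := hI.exists_smul_eq e x
  obtain ⟨l, d, hd, hgd⟩ := exists_eq_dis_mul_zpow hS e g.2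
  refine ⟨l, S.σ e ^ (-l) * d * (S.σ e ^ (-l))⁻¹,
    conj_mem_dis hS (σ_zpow_mem_permGroup S e (-l)) hd, ?_⟩
  rw [← hg, ← Equiv.Perm.mul_apply]
  change g.1 e = _
  rw [hgd]
  congr 1
  group

/-- Write `x = σ_e^l(d(e))`. Displacements can be dropped inside `σ`, and `σ_e^k` commutes past
`σ_e^l` to reach `e`, where it acts as a displacement. -/
theorem σ_zpow_apply_eq_of_mem_orbit (hS : S.ret.IsPermutationSolution)
    (hI : S.IsIndecomposable) {e : X} {k : ℤ} (hk : ∃ d ∈ S.dis, (S.σ e ^ k) e = d e) (x : X) :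
    S.σ ((S.σ e ^ k) x) = S.σ x := by
  have hG := σ_zpow_mem_permGroup S e
  obtain ⟨t, ht, hte⟩ := hk
  obtain ⟨l, d, hd, rfl⟩ := exists_zpow_apply_eq hS hI e x
  have h1 : ∀ j : ℤ, ∀ c ∈ S.dis, ∀ y, S.σ ((S.σ e ^ j) (c y)) = S.σ ((S.σ e ^ j) y) := by
    intro j c hc y
    have := σ_dis_apply hS (conj_mem_dis hS (hG j) hc) ((S.σ e ^ j) y)
    rw [← this, ← Equiv.Perm.mul_apply, ← Equiv.Perm.mul_apply]
    congr 2
    group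
  rw [← Equiv.Perm.mul_apply, ← zpow_add, h1 _ d hd, h1 _ d hd, add_comm, zpow_add,
    Equiv.Perm.mul_apply, hte, h1 _ t ht]

theorem zpow_commute_dis (hS : S.ret.IsPermutationSolution)
    (hI : S.IsIndecomposable) {e : X} {k : ℤ} (hk : ∃ d ∈ S.dis, (S.σ e ^ k) e = d e)
    {d : Equiv.Perm X} (hd : d ∈ S.dis) : Commute (S.σ e ^ k) d := by
  induction hd using Subgroup.closure_induction with
  | mem d hd =>
    obtain ⟨x, y, rfl⟩ := hd
    have := conj_σ_mul_inv hS (σ_zpow_mem_permGroup S e k) x y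
    rw [σ_zpow_apply_eq_of_mem_orbit hS hI hk, σ_zpow_apply_eq_of_mem_orbit hS hI hk] at this
    exact mul_inv_eq_iff_eq_mul.1 this
  | one => exact Commute.one_right _
  | mul d d' _ _ hd hd' => exact hd.mul_right hd'
  | inv d _ hd => exact hd.inv_right

/-- Coordinates on an indecomposable solution whose retraction is a permutation solution. -/
theorem exists_isomorphic_cyclicExt {A : Type} [AddCommGroup A] {m : ℕ} [NeZero m]
    (hS : S.ret.IsPermutationSolution) (hI : S.IsIndecomposable) (e : X)
    (hm : S.disIndex e = m) (π : S.dis →* Multiplicative A) (hπ : Function.Surjective π)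
    (hker : π.ker = MulAction.stabilizer S.dis e) :
    ∃ h w : ZMod m → A, h 0 = 0 ∧ (∀ B : AddSubgroup A, (∀ i, h i ∈ B) → B = ⊤) ∧
      Isomorphic.{u} ⟨_, cyclicExt h w⟩ ⟨X, S⟩ := by
  have hG := σ_zpow_mem_permGroup S e
  have horb : ∀ j : ℤ, (∃ d ∈ S.dis, (S.σ e ^ j) e = d e) ↔ (m : ℤ) ∣ j :=
    hm ▸ zpow_apply_mem_orbit_iff hS e
  have hcomm : ∀ d d' : S.dis, d * d' = d' * d := fun d d' =>
    Subtype.ext (dis_commute hS d.2 d'.2)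
  choose δ hδ using fun a : A => hπ (.ofAdd a)
  let s := S.σ e
  -- `ε` identifies `A` with the `Dis(X)`-orbit of `e`, and `Ψ a j` below transports this labelling
  -- by `s^j`.
  let ε : A → X := fun a => (δ a).1 e
  have hstab : ∀ d d' : S.dis, d.1 e = d'.1 e ↔ π d = π d' := by
    intro d d'
    rw [← inv_mul_eq_one (a := π d), ← map_inv, ← map_mul, ← MonoidHom.mem_ker, hker,
      MulAction.mem_stabilizer_iff]
    change _ ↔ (d.1⁻¹ * d'.1) e = e
    rw [Equiv.Perm.mul_apply, Equiv.Perm.inv_eq_iff_eq, eq_comm]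
  have hε : ∀ (d : S.dis) a, d.1 (ε a) = ε (a + (π d).toAdd) := fun d a => by
    change (d * δ a).1 e = _
    rw [hstab, map_mul, hδ, hδ, mul_comm]
    rfl
  have hεe : ∀ d : S.dis, d.1 e = ε (π d).toAdd := fun d => by
    rw [hstab, hδ]
    rfl
  have hεinj : Function.Injective ε := fun a b hab => by
    have := (hstab _ _).1 hab
    rw [hδ, hδ] at this
    exact this
  let Ψ : A → ℤ → X := fun a j => (s ^ j) (ε a)
  obtain ⟨t, ht, hte⟩ := (horb m).2 dvd_rfl
  -- The holonomy: applying `s` `m` times returns to the orbit of `e`, translated by `T`.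
  let T : A := (π ⟨t, ht⟩).toAdd
  have hΨm : ∀ a j, Ψ a (j + m) = Ψ (a + T) j := by
    intro a j
    have h1 : (s ^ (m : ℤ)) (ε a) = ε (a + T) := by
      rw [← hε ⟨t, ht⟩ a, ← Equiv.Perm.mul_apply]
      change (s ^ (m : ℤ) * (δ a).1) e = (⟨t, ht⟩ * δ a : S.dis).1 e
      rw [zpow_commute_dis hS hI ((horb m).2 dvd_rfl) (δ a).2, hcomm, Equiv.Perm.mul_apply]
      rw [hte]
      rfl
    change (s ^ (j + m)) (ε a) = (s ^ j) (ε (a + T))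
    rw [zpow_add, Equiv.Perm.mul_apply, h1]
  have hσΨ : ∀ a j, S.σ (Ψ a j) = S.σ ((s ^ j) e) := by
    intro a j
    rw [← σ_dis_apply hS (conj_mem_dis hS (hG j) (δ a).2) ((s ^ j) e), ← Equiv.Perm.mul_apply]
    change S.σ ((s ^ j * (δ a).1) e) = _
    congr 2
    change _ = s ^ j * (δ a).1 * (s ^ j)⁻¹ * s ^ j
    group
  let G : ℤ → A := fun i => (π ⟨S.σ ((s ^ i) e) * (S.σ e)⁻¹, σ_mul_inv_mem_dis S _ _⟩).toAdd
  have hGper : Function.Periodic G m := by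
    intro i
    have : S.σ ((s ^ (i + m)) e) = S.σ ((s ^ i) e) := by
      rw [add_comm, zpow_add, Equiv.Perm.mul_apply]
      exact σ_zpow_apply_eq_of_mem_orbit hS hI ((horb m).2 dvd_rfl) _
    simp only [G, this]
  let h : ZMod m → A := fun i => G i.val
  have hh : ∀ i : ℤ, G i = h i := fun i => (periodic_apply_val_intCast hGper i).symm
  have hπσ : ∀ i j : ℤ, (π ⟨S.σ ((s ^ i) e) * (S.σ ((s ^ j) e))⁻¹,
      σ_mul_inv_mem_dis S _ _⟩).toAdd = G i - G j := by
    intro i j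
    simp only [G]
    rw [← toAdd_div, ← map_div]
    congr 2
    exact Subtype.ext (by simp [div_eq_mul_inv])
  have hact : ∀ a b i j, S.σ (Ψ b i) (Ψ a j) =
      Ψ (a + (h (i - j - 1 : ℤ) - h (-j - 1 : ℤ))) (j + 1) := by
    intro a b i j
    rw [hσΨ, ← hh, ← hh, ← hπσ]
    change _ = (s ^ (j + 1)) (ε _)
    rw [← hε]
    -- Conjugation by `s^(j+1)` shifts the indices `i - j - 1` and `-j - 1` to `i` and `0`, turning
    -- the displacement into `σ s⁻¹`, with `σ` attached to `s^i(e)`.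
    have hc := conj_σ_mul_inv hS (hG (j + 1)) ((s ^ (i - j - 1)) e) ((s ^ (-j - 1)) e)
    change s ^ (j + 1) * _ * (s ^ (j + 1))⁻¹ =
      S.σ ((s ^ (j + 1)) _) * (S.σ ((s ^ (j + 1)) _))⁻¹ at hc
    rw [← Equiv.Perm.mul_apply, ← Equiv.Perm.mul_apply, ← zpow_add, ← zpow_add,
      show j + 1 + (i - j - 1) = i by ring, show j + 1 + (-j - 1) = 0 by ring, zpow_zero,
      Equiv.Perm.one_apply, mul_inv_eq_iff_eq_mul] at hc
    change _ = (s ^ (j + 1) * (S.σ ((s ^ (i - j - 1)) e) * (S.σ ((s ^ (-j - 1)) e))⁻¹)) (ε a)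
    rw [hc]
    change S.σ ((s ^ i) e) ((s ^ j) (ε a)) = (S.σ ((s ^ i) e) * s⁻¹ * s ^ (j + 1)) (ε a)
    rw [← Equiv.Perm.mul_apply]
    congr 1
    group
  -- The first term makes `s` itself (index `0`) carry fibre `j` to fibre `j + 1` without
  -- translation; the holonomy `T` enters only at the wrap-around from `m - 1` to `0`.
  let w : ZMod m → A := fun j => -h (-j - 1) + if j + 1 = 0 then T else 0
  have hstep : ∀ a (j : ZMod m), Ψ a (j.val + 1) =
      Ψ (a + if j + 1 = 0 then T else 0) (j + 1).val := by
    intro a j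
    split_ifs with hj
    · have h1 := val_add_one_eq_of_add_one_eq_zero hj
      have h2 := hΨm a 0
      rw [hj, ZMod.val_zero, Nat.cast_zero, ← h2]
      congr 1
      omega
    · rw [val_add_one_of_add_one_ne_zero hj, add_zero]
      simp
  have hdisc : ∀ {a a' : A} {j j' : ℤ}, Ψ a j = Ψ a' j' → (m : ℤ) ∣ j - j' := by
    intro a a' j j' hjj
    rw [← horb]
    have h1 : (s ^ (j - j') * (δ a).1) e = (δ a').1 e := by
      have : s ^ (j - j') * (δ a).1 = (s ^ j')⁻¹ * (s ^ j * (δ a).1) := by group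
      rw [this, Equiv.Perm.mul_apply, Equiv.Perm.inv_eq_iff_eq]
      exact hjj
    refine ⟨(s ^ (j - j') * (δ a).1 * (s ^ (j - j'))⁻¹)⁻¹ * (δ a').1,
      mul_mem (inv_mem (conj_mem_dis hS (hG _) (δ a).2)) (δ a').2, ?_⟩
    rw [Equiv.Perm.mul_apply, ← h1, ← Equiv.Perm.mul_apply]
    congr 1
    change s ^ (j - j') = _
    group
  have hrange : Function.Periodic (fun l => Set.range fun a => Ψ a l) m := by
    intro l
    ext x
    simp only [Set.mem_range, hΨm]
    exact ⟨fun ⟨a, ha⟩ => ⟨_, ha⟩, fun ⟨a, ha⟩ => ⟨a - T, by rwa [sub_add_cancel]⟩⟩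
  refine ⟨h, w, ?_, ?_, Equiv.ofBijective (fun x => Ψ x.down.1 x.down.2.val) ⟨?_, ?_⟩, ?_⟩
  · change G (0 : ZMod m).val = 0
    simp only [G, ZMod.val_zero]
    rw [toAdd_eq_zero]
    convert map_one π
    simp
  · intro B hB
    rw [eq_top_iff]
    intro a _
    -- Generators of `Dis(X)` map to differences of values of `h`, and `π` is onto, so these values
    -- generate `A`.
    have hall : ∀ d (hd : d ∈ S.dis), (π ⟨d, hd⟩).toAdd ∈ B := by
      intro d hd
      induction hd using Subgroup.closure_induction with
      | mem d hd =>
        obtain ⟨x, y, rfl⟩ := hd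
        have hx : ∀ x, ∃ i : ℤ, S.σ x = S.σ ((s ^ i) e) := fun x => by
          obtain ⟨l, d, hd, rfl⟩ := exists_zpow_apply_eq hS hI e x
          exact ⟨l, by rw [show d e = ε _ from hεe ⟨d, hd⟩]; exact hσΨ _ _⟩
        obtain ⟨i, hi⟩ := hx x
        obtain ⟨j, hj⟩ := hx y
        have := hπσ i j
        simp only [hi, hj]
        rw [this, hh, hh]
        exact B.sub_mem (hB _) (hB _)
      | one =>
        have : (π ⟨1, one_mem _⟩).toAdd = 0 := congrArg Multiplicative.toAdd (map_one π)
        exact this ▸ B.zero_mem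
      | mul d d' hd hd' ih ih' =>
        have : (π ⟨d * d', mul_mem hd hd'⟩).toAdd = (π ⟨d, hd⟩).toAdd + (π ⟨d', hd'⟩).toAdd :=
          congrArg Multiplicative.toAdd (map_mul π ⟨d, hd⟩ ⟨d', hd'⟩)
        exact this ▸ B.add_mem ih ih'
      | inv d hd ih =>
        have : (π ⟨d⁻¹, inv_mem hd⟩).toAdd = -(π ⟨d, hd⟩).toAdd :=
          congrArg Multiplicative.toAdd (map_inv π ⟨d, hd⟩)
        exact this ▸ B.neg_mem ih
    have := hall (δ a).1 (δ a).2
    rwa [Subtype.coe_eta, hδ] at this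
  · rintro ⟨⟨a, j⟩⟩ ⟨⟨a', j'⟩⟩ hx
    change Ψ a j.val = Ψ a' j'.val at hx
    have h1 := hdisc hx
    have h2 : j = j' := by
      rw [← ZMod.intCast_zmod_eq_zero_iff_dvd] at h1
      push_cast at h1
      simpa [sub_eq_zero] using h1
    subst h2
    rw [hεinj ((s ^ (j.val : ℤ)).injective hx)]
  · intro x
    obtain ⟨l, d, hd, rfl⟩ := exists_zpow_apply_eq hS hI e x
    have h1 : (S.σ e ^ l) (d e) ∈ Set.range fun a => Ψ a l := ⟨_, by rw [hεe ⟨d, hd⟩]⟩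
    rw [← periodic_apply_val_intCast hrange l] at h1
    obtain ⟨a, ha⟩ := h1
    exact ⟨⟨(a, l)⟩, ha⟩
  · rintro ⟨⟨b, i⟩⟩ ⟨⟨a, j⟩⟩
    change Ψ (a + h (i - j - 1) + w j) (j + 1).val = S.σ (Ψ b i.val) (Ψ a j.val)
    rw [hact, hstep]
    congr 1
    simp only [w]
    push_cast
    simp only [ZMod.natCast_val, ZMod.cast_id', id]
    abel

end Classification

/-! ### Counting parameters modulo units. -/

section Counting

/-- Parameters `(h, t)` of the solutions `cyclicExt`: a function on the nonzero elements of `ℤ/m`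
taking a unit as a value, and an element of `ℤ/n`. -/
def parameters (n m : ℕ) :
    SubMulAction (ZMod n)ˣ (({i : ZMod m // i ≠ 0} → ZMod n) × ZMod n) where
  carrier := {q | ∃ i, IsUnit (q.1 i)}
  smul_mem' := by
    rintro u q ⟨i, hi⟩
    exact ⟨i, u.isUnit.mul hi⟩

variable {n m : ℕ}

/-- Extension by zero. -/
def extendZero (g : {i : ZMod m // i ≠ 0} → ZMod n) (i : ZMod m) : ZMod n :=
  if hi : i = 0 then 0 else g ⟨i, hi⟩

theorem extendZero_zero (g : {i : ZMod m // i ≠ 0} → ZMod n) : extendZero g 0 = 0 := by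
  simp [extendZero]

theorem extendZero_coe (g : {i : ZMod m // i ≠ 0} → ZMod n) (i : {i : ZMod m // i ≠ 0}) :
    extendZero g i = g i := by
  simp [extendZero, i.2]

theorem extendZero_restrict {h : ZMod m → ZMod n} (h0 : h 0 = 0) :
    extendZero (fun i => h i) = h := by
  ext i
  by_cases hi : i = 0 <;> simp [extendZero, hi, h0]

theorem exists_isUnit_extendZero (q : parameters n m) :
    ∃ i, IsUnit (extendZero q.1.1 i) := by
  obtain ⟨i, hi⟩ := q.2
  exact ⟨i, by rwa [extendZero_coe]⟩

/-- The isomorphism class of the solution with the given parameters. -/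
def parametersClass (q : parameters n m) : Quotient isoSetoid.{u} :=
  Quotient.mk isoSetoid.{u} ⟨_, cyclicExt (extendZero q.1.1) (Pi.single 0 q.1.2)⟩

theorem parametersClass_eq_iff [NeZero n] [NeZero m] (q q' : parameters n m) :
    parametersClass.{u} q = parametersClass.{u} q' ↔
      MulAction.orbitRel (ZMod n)ˣ (parameters n m) q q' := by
  rw [MulAction.orbitRel_apply]
  constructor
  · intro hq
    have hiso : Isomorphic.{u} _ _ := Quotient.exact (s := isoSetoid.{u}) hq.symm
    obtain ⟨u, hu, hw⟩ := exists_units_of_cyclicExt_isomorphic (extendZero_zero _)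
      (extendZero_zero _) (exists_isUnit_extendZero q') hiso
    refine ⟨u, Subtype.ext (Prod.ext (funext fun i => ?_) ?_)⟩
    · have := hu i
      rwa [extendZero_coe, extendZero_coe] at this
    · change (u : ZMod n) * q'.1.2 = q.1.2
      simpa using hw
  · rintro ⟨u, rfl⟩
    refine (Quotient.sound (s := isoSetoid.{u})
      (cyclicExt_isomorphic_of_units u (fun i => ?_) ?_)).symm
    · by_cases hi : i = 0
      · simp [hi, extendZero_zero]
      · rw [extendZero_coe _ ⟨i, hi⟩, extendZero_coe _ ⟨i, hi⟩]
        rfl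
    · simp only [Finset.sum_pi_single', Finset.mem_univ, if_true]
      simp
      rfl

theorem card_parameters_mul [NeZero n] [NeZero m] :
    Nat.card (parameters n m) =
      Nat.card (Set.range (parametersClass.{u} (n := n) (m := m))) * n.totient := by
  -- A unit coordinate forces a stabilizing scalar to be `1`; hence every fibre of the class map has
  -- `φ(n)` elements.
  have hfree : ∀ q : parameters n m, MulAction.stabilizer (ZMod n)ˣ q = ⊥ := by
    intro q
    rw [eq_bot_iff]
    intro u hu
    obtain ⟨i, hi⟩ := q.2
    have h1 : (u : ZMod n) * q.1.1 i = 1 * q.1.1 i := by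
      rw [one_mul]
      exact congrFun (congrArg (fun r : parameters n m => r.1.1) hu) i
    exact Units.ext (hi.mul_right_cancel h1)
  have hker : Setoid.ker (parametersClass.{u} (n := n) (m := m)) =
      MulAction.orbitRel (ZMod n)ˣ (parameters n m) :=
    Setoid.ext fun q q' => parametersClass_eq_iff q q'
  rw [Nat.card_congr (MulAction.selfEquivOrbitsQuotientProd hfree), Nat.card_prod,
    ← Nat.card_congr (Setoid.quotientKerEquivRange _), hker,
    Nat.card_eq_fintype_card (α := (ZMod n)ˣ), ZMod.card_units_eq_totient]

theorem card_parameters [NeZero n] [NeZero m] :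
    Nat.card (parameters n m) + (n - n.totient) ^ (m - 1) * n = n ^ (m - 1) * n := by
  classical
  have hidx : Fintype.card {i : ZMod m // i ≠ 0} = m - 1 := by
    rw [Fintype.card_subtype_compl, ZMod.card, Fintype.card_subtype_eq]
  have hnon : Nat.card {a : ZMod n // ¬ IsUnit a} = n - n.totient := by
    rw [Nat.card_eq_fintype_card, Fintype.card_subtype_compl, ZMod.card,
      ← Nat.card_eq_fintype_card (α := {a : ZMod n // IsUnit a}),
      Nat.card_congr (Equiv.ofBijective (fun u : (ZMod n)ˣ => (⟨u, u.isUnit⟩ : {a : ZMod n // IsUnit a}))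
        ⟨fun u v huv => Units.ext (congrArg Subtype.val huv), fun ⟨_, u, hu⟩ =>
          ⟨u, Subtype.ext hu⟩⟩).symm, Nat.card_eq_fintype_card, ZMod.card_units_eq_totient]
  let e : {q : ({i : ZMod m // i ≠ 0} → ZMod n) × ZMod n // ¬ ∃ i, IsUnit (q.1 i)} ≃
      ({i : ZMod m // i ≠ 0} → {a : ZMod n // ¬ IsUnit a}) × ZMod n :=
    { toFun := fun q => (fun i => ⟨q.1.1 i, not_exists.1 q.2 i⟩, q.1.2)
      invFun := fun q => ⟨(fun i => q.1 i, q.2), not_exists.2 fun i => (q.1 i).2⟩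
      left_inv := fun q => rfl
      right_inv := fun q => rfl }
  have hcompl : Nat.card {q : ({i : ZMod m // i ≠ 0} → ZMod n) × ZMod n //
      ¬ ∃ i, IsUnit (q.1 i)} = (n - n.totient) ^ (m - 1) * n := by
    rw [Nat.card_congr e, Nat.card_prod, Nat.card_fun, hnon, Nat.card_eq_fintype_card, hidx,
      Nat.card_zmod]
  rw [← hcompl]
  change Nat.card {q : ({i : ZMod m // i ≠ 0} → ZMod n) × ZMod n // ∃ i, IsUnit (q.1 i)} + _ = _
  rw [Nat.card_eq_fintype_card, Nat.card_eq_fintype_card, Fintype.card_subtype_compl,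
    Nat.add_sub_cancel' (Fintype.card_subtype_le _), Fintype.card_prod, Fintype.card_fun, hidx,
    ZMod.card]

/-- In `ℤ/p^k` the non-units form the proper ideal `(p)`, so a family of non-units cannot generate.
-/
theorem exists_isUnit_of_forall_addSubgroup {ι : Type*} {p k : ℕ} (hp : p.Prime) (hk : k ≠ 0)
    {h : ι → ZMod (p ^ k)} (hh : ∀ B : AddSubgroup (ZMod (p ^ k)), (∀ i, h i ∈ B) → B = ⊤) :
    ∃ i, IsUnit (h i) := by
  have : NeZero (p ^ k) := ⟨pow_ne_zero _ hp.ne_zero⟩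
  by_contra! hn
  have h1 := hh (Ideal.span {(p : ZMod (p ^ k))}).toAddSubgroup fun i => by
    change h i ∈ Ideal.span {(p : ZMod (p ^ k))}
    rw [Ideal.mem_span_singleton]
    have h2 := hn i
    rw [← ZMod.natCast_zmod_val (h i), ZMod.isUnit_iff_coprime, Nat.coprime_pow_right_iff
      (Nat.pos_of_ne_zero hk), Nat.coprime_comm, hp.coprime_iff_not_dvd, not_not] at h2
    rw [← ZMod.natCast_zmod_val (h i)]
    exact Nat.cast_dvd_cast h2
  have h3 : (1 : ZMod (p ^ k)) ∈ (Ideal.span {(p : ZMod (p ^ k))}).toAddSubgroup :=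
    h1 ▸ AddSubgroup.mem_top _
  have h4 : IsUnit (p : ZMod (p ^ k)) := isUnit_of_dvd_one (Ideal.mem_span_singleton.1 h3)
  rw [ZMod.isUnit_iff_coprime, Nat.coprime_pow_right_iff (Nat.pos_of_ne_zero hk),
    Nat.coprime_self] at h4
  exact hp.one_lt.ne' h4

theorem classes_eq_range {A : Type v} [AddCommGroup A] {p k m : ℕ} [NeZero m] (hp : p.Prime)
    (hk : k ≠ 0) (φ : ZMod (p ^ k) ≃+ A) :
    classes.{u, v} A m = Set.range (parametersClass.{u} (n := p ^ k) (m := m)) := by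
  have : NeZero (p ^ k) := ⟨pow_ne_zero _ hp.ne_zero⟩
  have : Fact (1 < p ^ k) := ⟨Nat.one_lt_pow hk hp.one_lt⟩
  ext c
  constructor
  · rintro ⟨X, S, rfl, hI, hL, hX⟩
    have hS : S.ret.IsPermutationSolution := hL.2
    -- A base point exists because the double retraction is nonempty.
    obtain ⟨⟨c⟩, -⟩ := Nat.card_eq_one_iff_unique.1 hS |>.symm
    induction c using Quotient.inductionOn with | h c
    induction c using Quotient.inductionOn with | h e
    obtain ⟨⟨hN, ⟨ψ⟩⟩, hm⟩ := hX e
    let π : S.dis →* Multiplicative (ZMod (p ^ k)) :=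
      (ψ.trans (AddEquiv.toMultiplicative φ.symm)).toMonoidHom.comp
        (QuotientGroup.mk' (MulAction.stabilizer S.dis e))
    have hπ : Function.Surjective π :=
      (ψ.trans (AddEquiv.toMultiplicative φ.symm)).surjective.comp
        (QuotientGroup.mk'_surjective _)
    have hker : π.ker = MulAction.stabilizer S.dis e := by
      exact (MonoidHom.ker_mulEquiv_comp _ (ψ.trans (AddEquiv.toMultiplicative φ.symm))).trans
        (QuotientGroup.ker_mk' (MulAction.stabilizer S.dis e))
    obtain ⟨h, w, h0, hB, hiso⟩ := exists_isomorphic_cyclicExt hS hI e hm π hπ hker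
    obtain ⟨i, hi⟩ := exists_isUnit_of_forall_addSubgroup hp hk hB
    have hi0 : i ≠ 0 := by
      rintro rfl
      exact hi.ne_zero h0
    -- Concentrating `w` at `0` keeps its sum, hence the isomorphism class.
    refine ⟨⟨(fun i => h i, ∑ i, w i), ⟨i, hi0⟩, hi⟩, Quotient.sound (s := isoSetoid.{u}) ?_⟩
    refine isoSetoid.trans (cyclicExt_isomorphic_of_units 1 (fun i => ?_) ?_) hiso
    · simp [extendZero_restrict h0]
    · simp
  · rintro ⟨q, rfl⟩
    have h0 := extendZero_zero q.1.1
    have hu := exists_isUnit_extendZero q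
    exact ⟨_, _, rfl, cyclicExt_isIndecomposable _ _ h0 hu, cyclicExt_isLevelTwo _ _ h0 hu,
      fun e => ⟨cyclicExt_disQuotientIso _ _ φ h0 hu e, cyclicExt_disIndex _ _ h0 hu e⟩⟩

end Counting

end YBSolution

theorem mainTheorem9 (p k m : ℕ) (hp : p.Prime) (hk : 1 ≤ k) (hm : 1 < m)
    (A : Type v) [AddCommGroup A] [IsAddCyclic A] (hA : Nat.card A = p ^ k) :
    (YBSolution.classes.{u, v} A m).Finite ∧
      ((YBSolution.classes.{u, v} A m).ncard : ℚ) =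
        (p : ℚ) ^ ((k : ℤ) * m - m - k + 2) * (((p : ℚ) ^ (m - 1) - 1) / ((p : ℚ) - 1)) := by
  have : NeZero m := ⟨by omega⟩
  have : NeZero (p ^ k) := ⟨pow_ne_zero _ hp.ne_zero⟩
  have φ : ZMod (p ^ k) ≃+ A := (ZMod.ringEquivCongr hA.symm).toAddEquiv.trans
    (zmodAddCyclicAddEquiv inferInstance)
  rw [YBSolution.classes_eq_range.{u, v} hp (by omega) φ]
  refine ⟨Set.finite_range _, ?_⟩
  have h1 := YBSolution.card_parameters_mul.{u} (n := p ^ k) (m := m)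
  have h2 := YBSolution.card_parameters (n := p ^ k) (m := m)
  rw [h1, Nat.card_coe_set_eq] at h2
  generalize (Set.range _).ncard = N at h2 ⊢
  -- Shifting `k` and `m` by one removes truncated subtractions; the exponent in the formula becomes
  -- `k * m + 1`.
  obtain ⟨k, rfl⟩ : ∃ l, k = l + 1 := ⟨k - 1, by omega⟩
  obtain ⟨m, rfl⟩ : ∃ l, m = l + 1 := ⟨m - 1, by omega⟩
  have hp1 : ((p - 1 : ℕ) : ℚ) = p - 1 := by rw [Nat.cast_sub hp.one_le, Nat.cast_one]
  have h3 : p ^ (k + 1) - (p ^ (k + 1)).totient = p ^ k := by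
    have := Nat.sub_add_cancel hp.one_le
    rw [Nat.totient_prime_pow_succ hp, pow_succ, ← Nat.mul_sub, Nat.sub_sub_self hp.one_le,
      mul_one]
  rw [h3, Nat.totient_prime_pow_succ hp, Nat.add_sub_cancel] at h2
  have h4 := congrArg (Nat.cast : ℕ → ℚ) h2
  push_cast [hp1] at h4
  have hp0 : (p : ℚ) ≠ 0 := Nat.cast_ne_zero.2 hp.ne_zero
  have hp1' : (p : ℚ) - 1 ≠ 0 := sub_ne_zero.2 (Nat.cast_ne_one.2 hp.one_lt.ne')
  have hexp : (((k + 1 : ℕ) : ℤ) * (m + 1 : ℕ) - (m + 1 : ℕ) - (k + 1 : ℕ) + 2) =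
      ((k * m + 1 : ℕ) : ℤ) := by
    push_cast
    ring
  rw [hexp, zpow_natCast, Nat.add_sub_cancel, mul_div_assoc', eq_div_iff hp1']
  apply mul_left_cancel₀ (pow_ne_zero k hp0)
  linear_combination h4
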